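/- Let $p\in\mathbb N$, let $(\mathbf X,Y)$ and $(\mathbf X_n,Y_n)$, $n\in\mathbb N$, be random vectors with values in $\mathbb R^p\times\mathbb R$, where each vector may live on its own probability space. Let $Y'$ be a conditionally independent copy of $Y$ given $\mathbf X$: $Y'$ and $Y$ have the same conditional distribution given $\mathbf X=\mathbf x$ for $P^{\mathbf X}$-almost all $\mathbf x$, and $Y$, $Y'$ are conditionally independent given $\mathbf X$. Let $Y_n'$ be, likewise, a conditionally independent copy of $Y_n$ given $\mathbf X_n$. Let $V\subseteq\mathbb R^p$ be open with $P(\mathbf X\in V)=1$, and let $V_{\mathbf X}:=V\cap\operatorname{supp}(P^{\mathbf X})$ (so $V_{\mathbf X}=V$ if $V$ is contained in the support of $\mathbf X$). For $d=1,2$ let $\mathcal U(\mathbb R^d)$ be a convergence-determining class of bounded continuous functions $\mathbb R^d\to\mathbb C$, i.e. for probability measures $\nu_n,\nu$ on $\mathbb R^d$, $\int u\,d\nu_n\to\int u\,d\nu$ for all $u\in\mathcal U(\mathbb R^d)$ implies $\nu_n\to\nu$ weakly. A sequence of functions $f_n:\mathbb R^p\to\mathbb C$ is asymptotically equicontinuous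 on a set $A\subseteq\mathbb R^p$ if for all $\varepsilon>0$ and $\mathbf x\in A$ there are $\delta>0$ and $N\in\mathbb N$ such that $|f_n(\mathbf x')-f_n(\mathbf x)|<\varepsilon$ for all $n>N$ and all $\mathbf x'\in\mathbb R^p$ with $|\mathbf x'-\mathbf x|\le\delta$. Consider the statements (1) (i) $(\mathbf X_n,Y_n)\to(\mathbf X,Y)$ in distribution, and (ii) $(E[u(Y_n)\mid\mathbf X_n=\mathbf x])_{n}$ is asymptotically equicontinuous on $V_{\mathbf X}$ for all $u\in\mathcal U(\mathbb R)$; (2) (i) $(\mathbf X_n,Y_n,Y_n')\to(\mathbf X,Y,Y')$ in distribution, and (ii) $(E[u(Y_n,Y_n')\mid\mathbf X_n=\mathbf x])_{n}$ is asymptotically equicontinuous on $V_{\mathbf X}$ for all $u\in\mathcal U(\mathbb R^2)$. In both (ii), the conditional expectations are the integrals of $u$ with respect to regular conditional distributions given $\mathbf X_n=\mathbf x$; the condition requires that versions of these, not depending on $u$, can be chosen so that the stated property holds. Then: (a) (1) implies $(\mathbf X_n,Y_n,Y_n')\to(\mathbf X,Y,Y')$ in distribution, and in particular the Markov products converge,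 $(Y_n,Y_n')\to(Y,Y')$ in distribution. (b) (1) and (2) are equivalent, provided that at least one of the following holds: the conditional distributions of $Y$ given $\mathbf X=\mathbf x$ are locally tight on $V_{\mathbf X}$, meaning that they have a version $\kappa$ such that $\{\kappa(\mathbf x):\mathbf x\in K\}$ is tight for every compact $K\subseteq V_{\mathbf X}$ (for instance, a version that is weakly continuous on $V_{\mathbf X}$); or both classes $\mathcal U(\mathbb R)$, $\mathcal U(\mathbb R^2)$ are convergence-determining in the stronger sense that whenever $\nu_n$ are probability measures for which $\int u\,d\nu_n$ converges in $\mathbb C$ for every $u$ in the class, $\nu_n$ converges weakly to some probability measure (for instance, the classes of all bounded continuous functions). -/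

import Mathlib

open MeasureTheory ProbabilityTheory Filter Topology
open scoped BoundedContinuousFunction

/-- A class `U` of bounded continuous complex functions is (weak) convergence-determining: for
probability measures, convergence of the integrals of all `u ∈ U` to the integrals with respect to
a probability measure implies weak convergence to that measure. -/
def IsConvergenceDetermining {F : Type*} [TopologicalSpace F] [MeasurableSpace F]
    [OpensMeasurableSpace F] (U : Set (F →ᵇ ℂ)) : Prop :=
  ∀ (ν : ℕ → ProbabilityMeasure F) (ν₀ : ProbabilityMeasure F),
    (∀ u ∈ U, Tendsto (fun n => ∫ y, u y ∂(ν n : Measure F)) atTop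
      (𝓝 (∫ y, u y ∂(ν₀ : Measure F)))) →
    Tendsto ν atTop (𝓝 ν₀)

/-- The stronger form of the previous notion, in which the limit is not prescribed: if the integrals
of every `u ∈ U` converge to some complex number, then the probability measures converge weakly to
some probability measure. -/
def IsStronglyConvergenceDetermining {F : Type*} [TopologicalSpace F] [MeasurableSpace F]
    [OpensMeasurableSpace F] (U : Set (F →ᵇ ℂ)) : Prop :=
  ∀ ν : ℕ → ProbabilityMeasure F,
    (∀ u ∈ U, ∃ c : ℂ, Tendsto (fun n => ∫ y, u y ∂(ν n : Measure F)) atTop (𝓝 c)) →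
    ∃ ν₀ : ProbabilityMeasure F, Tendsto ν atTop (𝓝 ν₀)

/-- Asymptotic equicontinuity on `V` of a sequence of complex functions. -/
def AsymptoticallyEquicontinuousOn {E : Type*} [PseudoMetricSpace E] (f : ℕ → E → ℂ)
    (V : Set E) : Prop :=
  ∀ ε : ℝ, 0 < ε → ∀ x ∈ V, ∃ δ : ℝ, 0 < δ ∧ ∃ N : ℕ, ∀ x' : E, dist x' x ≤ δ →
    ∀ n : ℕ, N < n → ‖f n x' - f n x‖ < ε

/-- The sequence `x ↦ E[u(Zₙ) | Xₙ = x]` is asymptotically equicontinuous on `V` for all `u ∈ U`,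
for a suitable choice, for every `n`, of the regular conditional distribution of `Zₙ` given `Xₙ`
(which is determined only up to null sets of the law of `Xₙ`). The choice does not depend on `u`. -/
def CondExpAsymptoticallyEquicontinuousOn {E F : Type*} [PseudoMetricSpace E] [MeasurableSpace E]
    [TopologicalSpace F] [MeasurableSpace F] {Ω : ℕ → Type*} [∀ n, MeasurableSpace (Ω n)]
    (μ : ∀ n, Measure (Ω n)) (X : ∀ n, Ω n → E) (Z : ∀ n, Ω n → F) (U : Set (F →ᵇ ℂ))
    (V : Set E) : Prop :=
  ∃ κ : ℕ → Kernel E F, (∀ n, IsMarkovKernel (κ n)) ∧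
    (∀ n, HasCondDistrib (Z n) (X n) (κ n) (μ n)) ∧
    ∀ u ∈ U, AsymptoticallyEquicontinuousOn (fun n x => ∫ z, u z ∂(κ n x)) V

/-- `Y'` is a conditionally independent copy of `Y` given `X`: for almost every `x` the conditional
distributions of `Y'` and of `Y` given `X = x` agree, and `Y`, `Y'` are conditionally independent
given `X`. -/
structure IsCondIndepCopy {Ω E : Type*} [MeasurableSpace Ω] [MeasurableSpace E] (μ : Measure Ω)
    [IsProbabilityMeasure μ] (X : Ω → E) (Y Y' : Ω → ℝ) : Prop where
  condDistrib_eq : condDistrib Y' X μ =ᵐ[μ.map X] condDistrib Y X μ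
  condIndep : ∀ A B : Set ℝ, MeasurableSet A → MeasurableSet B →
    μ⟦Y ⁻¹' A ∩ Y' ⁻¹' B | MeasurableSpace.comap X inferInstance⟧ =ᵐ[μ]
      μ⟦Y ⁻¹' A | MeasurableSpace.comap X inferInstance⟧ *
        μ⟦Y' ⁻¹' B | MeasurableSpace.comap X inferInstance⟧

/-- The conditional distributions of `Y` given `X = x` are locally tight on `V`: for some version
of them, the family indexed by `x ∈ K` is tight for every compact `K ⊆ V`. -/
def CondDistribLocallyTightOn {Ω E : Type*} [MeasurableSpace Ω] [TopologicalSpace E]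
    [MeasurableSpace E] (μ : Measure Ω) (X : Ω → E) (Y : Ω → ℝ) (V : Set E) : Prop :=
  ∃ κ : Kernel E ℝ, IsMarkovKernel κ ∧ HasCondDistrib Y X κ μ ∧
    ∀ K : Set E, IsCompact K → K ⊆ V → IsTightMeasureSet ((fun x => κ x) '' K)

/-!
Let `κ n` be the conditional distributions of `Yn n` given `Xn n` and let `κ₀` be that of `Y` given
`X`. The proof turns on *continuous convergence*: `κ n x' → κ x` weakly as `n → ∞` and `x' → x`
jointly, expressed by the filter `atTop ×ˢ 𝓝 x`. This mode of convergence passes to products and to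
marginals of the kernels, and together with weak convergence of the laws of `Xn n` it gives weak
convergence of the joint laws (`tendsto_jointLaw_of_tendsto_kernelAt`), by an extended continuous
mapping theorem (`tendsto_map_of_continuousConvergence`).

To obtain continuous convergence, fix a point `x` of the support of `X` in `V` and a test function
`u`. By asymptotic equicontinuity, `∫ u d(κ n x)` is close to the average of `x' ↦ ∫ u d(κ n x')`
over a small ball around `x`; weak convergence of the pairs shows that this average converges to the
corresponding average of `κ₀` (`exists_seq_average_approx`). Two conclusions follow.

* At almost every `x`, the averages of `κ₀` over shrinking balls converge weakly to `κ₀ x`, by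
  Besicovitch differentiation applied to a countable π-system (`ae_tendsto_average_kernel`). The
  null set is independent of `u`, so an uncountable class of test functions causes no difficulty,
  and `κ n → κ₀` continuously almost everywhere (`ae_tendsto_kernelAt`). Since a conditionally
  independent copy has conditional distribution `κ₀ ×ₖ κ₀` for the pair, the triples converge.
* At every `x` of the support in `V`, the integrals `∫ u d(κ n x)` converge. That their limits come
  from a probability measure holds by definition for strongly convergence-determining classes, and
  follows from Prokhorov's theorem when `κ₀` is locally tight
  (`exists_tendsto_kernelAt_of_isTightMeasureSet`). Continuous convergence at every such point then
  transfers between `κ n` and the conditional distributions of the pairs, and yields asymptotic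
  equicontinuity for every bounded continuous function.
-/

/-! ### Weak convergence and continuously convergent integrands -/

/-- Extended continuous mapping theorem: if `Q n → Q₀` weakly and `f n` converges continuously to
`g` at almost every point, that is, `f n s' → g s` as `n → ∞` and `s' → s`, then the image measures
converge weakly. For open `G`, almost all of `g ⁻¹' G` is covered by the increasing open sets
`interior (⋂ n ≥ k, f n ⁻¹' G)`, to which the portmanteau theorem for `Q n` applies. -/
theorem tendsto_map_of_continuousConvergence {S T : Type*} [TopologicalSpace S]
    [MeasurableSpace S] [OpensMeasurableSpace S] [HasOuterApproxClosed S] [TopologicalSpace T]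
    [MeasurableSpace T] [BorelSpace T] {Q : ℕ → ProbabilityMeasure S} {Q₀ : ProbabilityMeasure S}
    (hQ : Tendsto Q atTop (𝓝 Q₀)) {f : ℕ → S → T} {g : S → T} (hf : ∀ n, Measurable (f n))
    (hg : Measurable g)
    (h : ∀ᵐ s ∂(Q₀ : Measure S),
      Tendsto (fun q : ℕ × S => f q.1 q.2) (atTop ×ˢ 𝓝 s) (𝓝 (g s))) :
    Tendsto (fun n => (Q n).map (hf n).aemeasurable) atTop (𝓝 (Q₀.map hg.aemeasurable)) := by
  refine tendsto_of_forall_isOpen_le_liminf' fun G hG => ?_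
  simp only [ProbabilityMeasure.toMeasure_map]
  rw [Measure.map_apply hg hG.measurableSet]
  set O : ℕ → Set S := fun k => interior (⋂ n ≥ k, f n ⁻¹' G)
  have hmono : Monotone O := fun a b hab =>
    interior_mono (Set.biInter_subset_biInter_left fun n (hn : b ≤ n) => hab.trans hn)
  calc (Q₀ : Measure S) (g ⁻¹' G) ≤ (Q₀ : Measure S) (⋃ k, O k) := by
        refine measure_mono_ae ?_
        filter_upwards [h] with s hs hsG
        have := hs (hG.mem_nhds hsG)
        obtain ⟨A, hA, B, hB, hAB⟩ := mem_prod_iff.1 (mem_map.1 this)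
        obtain ⟨k, hk⟩ := mem_atTop_sets.1 hA
        refine Set.mem_iUnion.2 ⟨k, mem_interior_iff_mem_nhds.2 (mem_of_superset hB fun b hb => ?_)⟩
        exact Set.mem_iInter₂.2 fun n hn => hAB (Set.mk_mem_prod (hk n hn) hb)
    _ = ⨆ k, (Q₀ : Measure S) (O k) := hmono.measure_iUnion
    _ ≤ liminf (fun n => ((Q n : Measure S).map (f n)) G) atTop := by
        refine iSup_le fun k => ?_
        refine (ProbabilityMeasure.le_liminf_measure_open_of_tendsto hQ isOpen_interior).trans ?_
        refine liminf_le_liminf ?_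
        filter_upwards [eventually_ge_atTop k] with n hn
        rw [Measure.map_apply (hf n) hG.measurableSet]
        exact measure_mono (interior_subset.trans (Set.biInter_subset_of_mem hn))

/-- The radial retraction onto a large ball is a bounded continuous function extending the
identity. -/
theorem exists_boundedContinuousFunction_eqOn_closedBall {𝕜 : Type*} [RCLike 𝕜] (M : ℝ) :
    ∃ φ : 𝕜 →ᵇ 𝕜, ∀ z, ‖z‖ ≤ M → φ z = z := by
  -- the radius is enlarged to be positive, whatever the sign of `M`
  set R := max M 1
  have hR : 0 < R := lt_max_of_lt_right one_pos
  have hpos : ∀ z : 𝕜, 0 < max R ‖z‖ := fun z => lt_max_of_lt_left hR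
  refine ⟨BoundedContinuousFunction.ofNormedAddCommGroup
    (fun z => (R / max R ‖z‖) • z) ?_ R fun z => ?_, fun z hz => ?_⟩
  · exact (continuous_const.div (by fun_prop) fun z => (hpos z).ne').smul continuous_id
  · rw [norm_smul, Real.norm_of_nonneg (div_nonneg hR.le (hpos z).le), div_mul_eq_mul_div,
      div_le_iff₀ (hpos z)]
    exact mul_le_mul_of_nonneg_left (le_max_right _ _) hR.le
  · have : max R ‖z‖ = R := max_eq_left (hz.trans (le_max_left _ _))
    simp [this, div_self hR.ne']

/-- Integrals of uniformly bounded, almost everywhere continuously convergent functions converge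
along a weakly convergent sequence of probability measures. -/
theorem tendsto_integral_of_continuousConvergence {S 𝕜 : Type*} [RCLike 𝕜] [TopologicalSpace S]
    [MeasurableSpace S] [OpensMeasurableSpace S] [HasOuterApproxClosed S]
    {Q : ℕ → ProbabilityMeasure S} {Q₀ : ProbabilityMeasure S}
    (hQ : Tendsto Q atTop (𝓝 Q₀)) {f : ℕ → S → 𝕜} {g : S → 𝕜} (hf : ∀ n, Measurable (f n))
    (hg : Measurable g) {M : ℝ} (hfM : ∀ n s, ‖f n s‖ ≤ M) (hgM : ∀ s, ‖g s‖ ≤ M)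
    (h : ∀ᵐ s ∂(Q₀ : Measure S),
      Tendsto (fun q : ℕ × S => f q.1 q.2) (atTop ×ˢ 𝓝 s) (𝓝 (g s))) :
    Tendsto (fun n => ∫ s, f n s ∂(Q n : Measure S)) atTop
      (𝓝 (∫ s, g s ∂(Q₀ : Measure S))) := by
  obtain ⟨φ, hφ⟩ := exists_boundedContinuousFunction_eqOn_closedBall (𝕜 := 𝕜) M
  have := (ProbabilityMeasure.tendsto_iff_forall_integral_rclike_tendsto 𝕜).1
    (tendsto_map_of_continuousConvergence hQ hf hg h) φ
  simp only [ProbabilityMeasure.toMeasure_map] at this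
  rw [integral_map hg.aemeasurable φ.continuous.aestronglyMeasurable] at this
  refine (this.congr fun n => ?_).trans_eq ?_
  · rw [integral_map (hf n).aemeasurable φ.continuous.aestronglyMeasurable]
    exact integral_congr_ae (ae_of_all _ fun s => hφ _ (hfM n s))
  · rw [integral_congr_ae (ae_of_all _ fun s => hφ _ (hgM s))]

/-! ### Differentiation of kernels -/

/-- The finite intersections of the sets of a countable basis. Convergence on the members of this
countable π-system implies weak convergence, which is what allows a single exceptional null set in
`ae_tendsto_average_kernel`. -/
theorem exists_countable_isPiSystem_basis (F : Type*) [TopologicalSpace F]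
    [SecondCountableTopology F] :
    ∃ S : Set (Set F), S.Countable ∧ IsPiSystem S ∧ (∀ s ∈ S, IsOpen s) ∧
      ∀ u : Set F, IsOpen u → ∀ x ∈ u, ∃ s ∈ S, s ∈ 𝓝 x ∧ s ⊆ u := by
  have hb := TopologicalSpace.isBasis_countableBasis F
  refine ⟨(fun T => ⋂₀ T) '' {T | T.Finite ∧ T ⊆ TopologicalSpace.countableBasis F},
    (Set.countable_ofPred_finite_subset (TopologicalSpace.countable_countableBasis F)).image _,
    ?_, ?_, ?_⟩
  · rintro _ ⟨T, ⟨hT, hT'⟩, rfl⟩ _ ⟨T', ⟨hT1, hT1'⟩, rfl⟩ -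
    exact ⟨T ∪ T', ⟨hT.union hT1, Set.union_subset hT' hT1'⟩, Set.sInter_union _ _⟩
  · rintro _ ⟨T, ⟨hT, hT'⟩, rfl⟩
    exact hT.isOpen_sInter fun s hs => hb.isOpen (hT' hs)
  · intro u hu x hx
    obtain ⟨s, hs, hxs, hsu⟩ := hb.exists_subset_of_mem_open hx hu
    exact ⟨s, ⟨{s}, ⟨Set.finite_singleton _, by simpa using hs⟩, by simp⟩,
      (hb.isOpen hs).mem_nhds hxs, hsu⟩

/-- The value of a Markov kernel at a point, as a point of the space of probability measures with
the topology of weak convergence. -/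
abbrev kernelAt {E F : Type*} [MeasurableSpace E] [MeasurableSpace F] (κ : Kernel E F)
    [IsMarkovKernel κ] (x : E) : ProbabilityMeasure F :=
  ⟨κ x, inferInstance⟩

theorem kernelAt_prod_self {E F : Type*} [MeasurableSpace E] [MeasurableSpace F] (κ : Kernel E F)
    [IsMarkovKernel κ] (x : E) : kernelAt (κ ×ₖ κ) x = (kernelAt κ x).prod (kernelAt κ x) :=
  Subtype.ext (Kernel.prod_apply κ κ x)

theorem norm_integral_boundedContinuousFunction_le {F : Type*} [TopologicalSpace F]
    [MeasurableSpace F] (u : F →ᵇ ℂ) (ν : Measure F) [IsProbabilityMeasure ν] :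
    ‖∫ z, u z ∂ν‖ ≤ ‖u‖ := by
  simpa using norm_integral_le_of_norm_le_const (μ := ν) (ae_of_all _ u.norm_coe_le_norm)

theorem measurable_integral_boundedContinuousFunction {E F : Type*} [MeasurableSpace E]
    [TopologicalSpace F] [MeasurableSpace F] [BorelSpace F] [SecondCountableTopology F]
    (κ : Kernel E F) [IsMarkovKernel κ] (u : F →ᵇ ℂ) : Measurable fun x => ∫ z, u z ∂(κ x) := by
  have : StronglyMeasurable fun p : E × F => u p.2 :=
    (u.continuous.stronglyMeasurable).comp_measurable measurable_snd
  exact (this.integral_kernel_prod_right' (κ := κ)).measurable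

theorem integrable_integral_boundedContinuousFunction {E F : Type*} [MeasurableSpace E]
    [TopologicalSpace F] [MeasurableSpace F] [BorelSpace F] [SecondCountableTopology F]
    (κ : Kernel E F) [IsMarkovKernel κ] (u : F →ᵇ ℂ) (μ : Measure E) [IsFiniteMeasure μ] :
    Integrable (fun x => ∫ z, u z ∂(κ x)) μ :=
  Integrable.of_bound (measurable_integral_boundedContinuousFunction κ u).aestronglyMeasurable ‖u‖
    (ae_of_all _ fun x => norm_integral_boundedContinuousFunction_le u (κ x))

/-- Lebesgue differentiation for a kernel, with respect to an arbitrary finite measure: at almost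
every point the averages of `κ` over small closed balls converge weakly to `κ x`. The exceptional
null set does not depend on the test function `u`. -/
theorem ae_tendsto_average_kernel {E F : Type*} [MetricSpace E] [MeasurableSpace E] [BorelSpace E]
    [SecondCountableTopology E] [HasBesicovitchCovering E]
    [TopologicalSpace F] [MeasurableSpace F] [BorelSpace F] [SecondCountableTopology F]
    [HasOuterApproxClosed F]
    (μ : Measure E) [IsFiniteMeasure μ] (κ : Kernel E F) [IsMarkovKernel κ] :
    ∀ᵐ x ∂μ, ∀ u : F →ᵇ ℂ,
      Tendsto (fun r => ⨍ x' in Metric.closedBall x r, ∫ z, u z ∂(κ x') ∂μ) (𝓝[>] 0)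
        (𝓝 (∫ z, u z ∂(κ x))) := by
  obtain ⟨S, hSc, hSpi, hSo, hSnhds⟩ := exists_countable_isPiSystem_basis F
  have hint : ∀ s ∈ S, Integrable (fun x => (κ x).real s) μ := fun s hs =>
    Integrable.of_bound ((κ.measurable_coe (hSo s hs).measurableSet).ennreal_toReal
      |>.aestronglyMeasurable) 1 (ae_of_all _ fun x => by
        rw [Real.norm_of_nonneg measureReal_nonneg]; exact measureReal_le_one)
  have key : ∀ᵐ x ∂μ, ∀ s ∈ S,
      Tendsto (fun r => ⨍ x' in Metric.closedBall x r, (κ x').real s ∂μ) (𝓝[>] 0)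
        (𝓝 ((κ x).real s)) := by
    refine (ae_ball_iff hSc).2 fun s hs => ?_
    filter_upwards [(Besicovitch.vitaliFamily μ).ae_tendsto_average (hint s hs).locallyIntegrable]
      with x hx using hx.comp (Besicovitch.tendsto_filterAt μ x)
  have hsupp : ∀ᵐ x ∂μ, x ∈ μ.support := Measure.support_mem_ae
  filter_upwards [key, hsupp] with x hx hxs u
  -- the radius is modified outside `(0, ∞)` so that the averaged measure is always defined
  set ρ : ℝ → ℝ := fun r => if 0 < r then r else 1 with hρ
  have hρpos : ∀ r, 0 < ρ r := fun r => by
    simp only [hρ]; split_ifs with h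
    exacts [h, one_pos]
  have hρeq : ∀ᶠ r in 𝓝[>] (0 : ℝ), ρ r = r := by
    filter_upwards [self_mem_nhdsWithin] with r (hr : 0 < r)
    simp [hρ, hr]
  have hB : ∀ r, μ (Metric.closedBall x (ρ r)) ≠ 0 := fun r =>
    ((Measure.mem_support_iff_forall x).1 hxs _ (Metric.closedBall_mem_nhds x (hρpos r))).ne'
  let m : ℝ → Measure E := fun r => cond μ (Metric.closedBall x (ρ r))
  have hm : ∀ r, IsProbabilityMeasure (m r) := fun r => cond_isProbabilityMeasure (hB r)
  let ν : ℝ → ProbabilityMeasure F := fun r => ⟨(m r).bind κ, inferInstance⟩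
  have hν : Tendsto ν (𝓝[>] 0) (𝓝 (kernelAt κ x)) := by
    refine hSpi.tendsto_probabilityMeasure_of_tendsto_of_mem
      (fun s hs => (hSo s hs).measurableSet) hSnhds fun s hs => ?_
    have h1 := hx s hs
    rw [← NNReal.tendsto_coe]
    simp only [← ProbabilityMeasure.measureReal_eq_coe_coeFn]
    refine h1.congr' ?_
    filter_upwards [hρeq] with r hr
    have : ((m r).bind κ).real s = ∫ x', (κ x').real s ∂(m r) := by
      rw [Measure.real, Measure.bind_apply (hSo s hs).measurableSet κ.aemeasurable,
        ← integral_toReal (κ.measurable_coe (hSo s hs).measurableSet).aemeasurable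
          (ae_of_all _ fun _ => measure_lt_top _ _)]
      rfl
    rw [setAverage_eq']
    change _ = ((m r).bind κ).real s
    rw [this]
    simp only [m, ProbabilityTheory.cond, hr]
  have := (ProbabilityMeasure.tendsto_iff_forall_integral_rclike_tendsto ℂ).1 hν u
  refine this.congr' ?_
  filter_upwards [hρeq] with r hr
  change ∫ z, u z ∂((m r).bind κ) = _
  rw [← Measure.snd_compProd, Measure.snd, integral_map measurable_snd.aemeasurable
    u.continuous.aestronglyMeasurable, Measure.integral_compProd, setAverage_eq']
  swap
  · exact Integrable.of_bound (u.continuous.measurable.comp measurable_snd).aestronglyMeasurable ‖u‖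
      (ae_of_all _ fun p => u.norm_coe_le_norm p.2)
  simp only [m, ProbabilityTheory.cond, hr]

/-! ### Local averages of conditional expectations -/

/-- The law on `E × F` with first marginal `μ` and conditional distribution `κ` of the second
coordinate given the first. -/
noncomputable abbrev jointLaw {E F : Type*} [MeasurableSpace E] [MeasurableSpace F] (μ : Measure E)
    [IsProbabilityMeasure μ] (κ : Kernel E F) [IsMarkovKernel κ] : ProbabilityMeasure (E × F) :=
  ⟨μ ⊗ₘ κ, inferInstance⟩

section Averages

variable {E F : Type*} [MetricSpace E] [MeasurableSpace E] [BorelSpace E]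
  [SecondCountableTopology E] [MetricSpace F] [MeasurableSpace F] [BorelSpace F]
  [SecondCountableTopology F] {μ : ℕ → Measure E} [∀ n, IsProbabilityMeasure (μ n)]
  {μ₀ : Measure E} [IsProbabilityMeasure μ₀] {κ : ℕ → Kernel E F} [∀ n, IsMarkovKernel (κ n)]
  {κ₀ : Kernel E F} [IsMarkovKernel κ₀]

/-- Weak convergence of the joint laws gives convergence of the integrals of the conditional
expectations over continuity sets of `μ₀`: on the product space these are integrals of a bounded
function that is discontinuous only over the frontier of `B`. -/
theorem tendsto_setIntegral_kernel
    (hQ : Tendsto (fun n => jointLaw (μ n) (κ n)) atTop (𝓝 (jointLaw μ₀ κ₀))) {B : Set E}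
    (hB : MeasurableSet B) (hfr : μ₀ (frontier B) = 0) (u : F →ᵇ ℂ) :
    Tendsto (fun n => ∫ x in B, ∫ z, u z ∂(κ n x) ∂(μ n)) atTop
      (𝓝 (∫ x in B, ∫ z, u z ∂(κ₀ x) ∂μ₀)) := by
  set g : E × F → ℂ := (B ×ˢ Set.univ).indicator fun p => u p.2 with hg
  have hBm : MeasurableSet (B ×ˢ (Set.univ : Set F)) := hB.prod MeasurableSet.univ
  have hgm : Measurable g := (u.continuous.measurable.comp measurable_snd).indicator hBm
  have hgM : ∀ p, ‖g p‖ ≤ ‖u‖ := fun p =>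
    (norm_indicator_le_norm_self _ _).trans (u.norm_coe_le_norm _)
  have hint : ∀ (m : Measure E) [IsProbabilityMeasure m] (k : Kernel E F) [IsMarkovKernel k],
      ∫ p, g p ∂(m ⊗ₘ k) = ∫ x in B, ∫ z, u z ∂(k x) ∂m := by
    intro m _ k _
    rw [hg, integral_indicator hBm, Measure.setIntegral_compProd hB MeasurableSet.univ]
    · simp
    · exact (Integrable.of_bound
        (u.continuous.measurable.comp measurable_snd).aestronglyMeasurable ‖u‖
        (ae_of_all _ fun p => u.norm_coe_le_norm p.2)).integrableOn
  have hae : ∀ᵐ p ∂(μ₀ ⊗ₘ κ₀), p.1 ∉ frontier B := by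
    have : ∀ᵐ x ∂((μ₀ ⊗ₘ κ₀).map Prod.fst), x ∉ frontier B := by
      rw [← Measure.fst, Measure.fst_compProd]
      exact measure_eq_zero_iff_ae_notMem.1 hfr
    exact ae_of_ae_map measurable_fst.aemeasurable this
  have := tendsto_integral_of_continuousConvergence hQ (f := fun _ => g) (g := g) (fun _ => hgm)
    hgm (fun _ => hgM) hgM ?_
  · simpa only [ProbabilityMeasure.coe_mk, hint] using this
  filter_upwards [hae] with p hp
  suffices h : ContinuousAt g p from h.tendsto.comp tendsto_snd
  have hu : ContinuousAt (fun p : E × F => u p.2) p := by fun_prop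
  rw [frontier_eq_closure_inter_closure, Set.mem_inter_iff, not_and_or,
    ← Set.mem_compl_iff, ← Set.mem_compl_iff, ← interior_compl, ← interior_compl, compl_compl] at hp
  rcases hp with hp | hp
  · refine (continuousAt_const (y := (0 : ℂ))).congr ?_
    filter_upwards [continuousAt_fst.preimage_mem_nhds (mem_interior_iff_mem_nhds.1 hp)] with q hq
    exact (Set.indicator_of_notMem (fun h => hq h.1) _).symm
  · refine hu.congr ?_
    filter_upwards [continuousAt_fst.preimage_mem_nhds (mem_interior_iff_mem_nhds.1 hp)] with q hq
    exact (Set.indicator_of_mem (s := B ×ˢ Set.univ) ⟨hq, trivial⟩ fun p : E × F => u p.2).symm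

theorem tendsto_measureReal_of_tendsto_jointLaw
    (hQ : Tendsto (fun n => jointLaw (μ n) (κ n)) atTop (𝓝 (jointLaw μ₀ κ₀))) {B : Set E}
    (hB : MeasurableSet B) (hfr : μ₀ (frontier B) = 0) :
    Tendsto (fun n => (μ n).real B) atTop (𝓝 (μ₀.real B)) := by
  -- the test function `u = 1` integrates to the mass of `B`
  have := (Complex.continuous_re.tendsto _).comp
    (tendsto_setIntegral_kernel hQ hB hfr (BoundedContinuousFunction.const F 1))
  simpa [Function.comp_def] using this

theorem tendsto_setAverage_kernel
    (hQ : Tendsto (fun n => jointLaw (μ n) (κ n)) atTop (𝓝 (jointLaw μ₀ κ₀))) {B : Set E}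
    (hB : MeasurableSet B) (hfr : μ₀ (frontier B) = 0) (hB₀ : μ₀ B ≠ 0) (u : F →ᵇ ℂ) :
    Tendsto (fun n => ⨍ x in B, ∫ z, u z ∂(κ n x) ∂(μ n)) atTop
      (𝓝 (⨍ x in B, ∫ z, u z ∂(κ₀ x) ∂μ₀)) := by
  simp only [setAverage_eq]
  refine ((tendsto_measureReal_of_tendsto_jointLaw hQ hB hfr).inv₀ ?_).smul
    (tendsto_setIntegral_kernel hQ hB hfr u)
  exact (measureReal_ne_zero_iff).2 hB₀

/-- If `x' ↦ ∫ u d(κ n x')` varies by less than `ε` on a ball around `x`, then its value at `x` is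
within `ε` of its `μ n`-average over the ball, and those averages converge to the average in the
limit. -/
theorem eventually_norm_sub_setAverage_le
    (hQ : Tendsto (fun n => jointLaw (μ n) (κ n)) atTop (𝓝 (jointLaw μ₀ κ₀))) (u : F →ᵇ ℂ)
    {x : E} {r ε : ℝ} (hε : 0 < ε) {N : ℕ} (hfr : μ₀ (frontier (Metric.closedBall x r)) = 0)
    (hB₀ : μ₀ (Metric.closedBall x r) ≠ 0)
    (hN : ∀ x', dist x' x ≤ r → ∀ n, N < n →
      ‖(∫ z, u z ∂(κ n x')) - ∫ z, u z ∂(κ n x)‖ < ε) :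
    ∀ᶠ n in atTop, ‖(∫ z, u z ∂(κ n x)) -
      ⨍ x' in Metric.closedBall x r, ∫ z, u z ∂(κ₀ x') ∂μ₀‖ ≤ 2 * ε := by
  have hB : MeasurableSet (Metric.closedBall x r) := measurableSet_closedBall
  have hpos := (tendsto_measureReal_of_tendsto_jointLaw hQ hB hfr).eventually_ne
    ((measureReal_ne_zero_iff).2 hB₀)
  have hav := (Metric.tendsto_nhds.1 (tendsto_setAverage_kernel hQ hB hfr hB₀ u)) ε hε
  filter_upwards [hpos, hav, eventually_gt_atTop N] with n h1 h2 h3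
  have hmem : (⨍ x' in Metric.closedBall x r, ∫ z, u z ∂(κ n x') ∂(μ n)) ∈
      Metric.closedBall (∫ z, u z ∂(κ n x)) ε := by
    refine (convex_closedBall _ _).set_average_mem Metric.isClosed_closedBall
      ((measureReal_ne_zero_iff).1 h1) (measure_ne_top _ _) ?_
      (integrable_integral_boundedContinuousFunction (κ n) u (μ n)).integrableOn
    filter_upwards [ae_restrict_mem hB] with x' hx'
    rw [Metric.mem_closedBall, dist_eq_norm]
    exact (hN x' hx' n h3).le
  rw [Metric.mem_closedBall, dist_comm] at hmem
  rw [← dist_eq_norm]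
  linarith [dist_triangle (∫ z, u z ∂(κ n x))
    (⨍ x' in Metric.closedBall x r, ∫ z, u z ∂(κ n x') ∂(μ n))
    (⨍ x' in Metric.closedBall x r, ∫ z, u z ∂(κ₀ x') ∂μ₀)]

end Averages

/-- Under asymptotic equicontinuity, pointwise convergence at `x` is continuous convergence at
`x`. -/
theorem tendsto_prod_nhds_of_asymptoticallyEquicontinuousOn {E : Type*} [PseudoMetricSpace E]
    {f : ℕ → E → ℂ} {A : Set E} (hf : AsymptoticallyEquicontinuousOn f A) {x : E} (hx : x ∈ A)
    {c : ℂ} (hc : Tendsto (fun n => f n x) atTop (𝓝 c)) :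
    Tendsto (fun q : ℕ × E => f q.1 q.2) (atTop ×ˢ 𝓝 x) (𝓝 c) := by
  refine Metric.tendsto_nhds.2 fun ε hε => ?_
  obtain ⟨δ, hδ, N, hN⟩ := hf (ε / 2) (half_pos hε) x hx
  have h1 : ∀ᶠ n in atTop, N < n ∧ dist (f n x) c < ε / 2 :=
    (eventually_gt_atTop N).and (Metric.tendsto_nhds.1 hc _ (half_pos hε))
  filter_upwards [h1.prod_mk (Metric.closedBall_mem_nhds x hδ)] with q hq
  have := hN q.2 hq.2 q.1 hq.1.1
  rw [← dist_eq_norm] at this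
  linarith [dist_triangle (f q.1 q.2) (f q.1 x) c, hq.1.2]

theorem asymptoticallyEquicontinuousOn_of_tendsto {E : Type*} [PseudoMetricSpace E]
    {f : ℕ → E → ℂ} {A : Set E}
    (h : ∀ x ∈ A, ∃ c, Tendsto (fun q : ℕ × E => f q.1 q.2) (atTop ×ˢ 𝓝 x) (𝓝 c)) :
    AsymptoticallyEquicontinuousOn f A := by
  intro ε hε x hx
  obtain ⟨c, hc⟩ := h x hx
  have := Metric.tendsto_nhds.1 hc (ε / 2) (half_pos hε)
  obtain ⟨S, hS, T, hT, hST⟩ := mem_prod_iff.1 this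
  obtain ⟨N, hN⟩ := mem_atTop_sets.1 hS
  obtain ⟨δ, hδ, hδT⟩ := Metric.nhds_basis_closedBall.mem_iff.1 hT
  refine ⟨δ, hδ, N, fun x' hx' n hn => ?_⟩
  have h1 : dist (f n x') c < ε / 2 := hST (Set.mk_mem_prod (hN n hn.le) (hδT hx'))
  have h2 : dist (f n x) c < ε / 2 := hST (Set.mk_mem_prod (hN n hn.le) (mem_of_mem_nhds hT))
  rw [← dist_eq_norm]
  linarith [dist_triangle_right (f n x') (f n x) c]

/-! ### Continuous convergence of the conditional distributions -/

/-- For an asymptotically equicontinuous convergence-determining class, convergence of the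
integrals at the point `x` alone implies continuous weak convergence of the kernels at `x`. -/
theorem tendsto_kernelAt_of_isConvergenceDetermining {E F : Type*} [PseudoMetricSpace E]
    [MeasurableSpace E] [TopologicalSpace F] [MeasurableSpace F] [OpensMeasurableSpace F]
    {κ : ℕ → Kernel E F} [∀ n, IsMarkovKernel (κ n)] {U : Set (F →ᵇ ℂ)}
    (hU : IsConvergenceDetermining U) {A : Set E}
    (hA : ∀ u ∈ U, AsymptoticallyEquicontinuousOn (fun n x => ∫ z, u z ∂(κ n x)) A) {x : E}
    (hx : x ∈ A) {ν : ProbabilityMeasure F}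
    (hν : ∀ u ∈ U, Tendsto (fun n => ∫ z, u z ∂(κ n x)) atTop (𝓝 (∫ z, u z ∂(ν : Measure F)))) :
    Tendsto (fun q : ℕ × E => kernelAt (κ q.1) q.2) (atTop ×ˢ 𝓝 x) (𝓝 ν) := by
  refine tendsto_of_seq_tendsto fun q hq => hU _ _ fun u hu => ?_
  exact (tendsto_prod_nhds_of_asymptoticallyEquicontinuousOn (hA u hu) hx (hν u hu)).comp hq

theorem tendsto_integral_of_tendsto_kernelAt {E F : Type*} [TopologicalSpace E]
    [MeasurableSpace E] [TopologicalSpace F] [MeasurableSpace F] [OpensMeasurableSpace F]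
    {κ : ℕ → Kernel E F} [∀ n, IsMarkovKernel (κ n)] {x : E} {ν : ProbabilityMeasure F}
    (h : Tendsto (fun q : ℕ × E => kernelAt (κ q.1) q.2) (atTop ×ˢ 𝓝 x) (𝓝 ν)) (u : F →ᵇ ℂ) :
    Tendsto (fun q : ℕ × E => ∫ z, u z ∂(κ q.1 q.2)) (atTop ×ˢ 𝓝 x)
      (𝓝 (∫ z, u z ∂(ν : Measure F))) :=
  (ProbabilityMeasure.tendsto_iff_forall_integral_rclike_tendsto ℂ).1 h u

theorem exists_seq_closedBall_frontier_null {E : Type*} [NormedAddCommGroup E] [NormedSpace ℝ E]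
    [MeasurableSpace E] [OpensMeasurableSpace E] (μ : Measure E) [SFinite μ] (x : E) :
    ∃ r : ℕ → ℝ, Tendsto r atTop (𝓝 0) ∧
      ∀ k, 0 < r k ∧ μ (frontier (Metric.closedBall x (r k))) = 0 := by
  obtain ⟨r, hr, h⟩ := exists_null_frontiers_thickening μ {x}
  refine ⟨r, hr, fun k => ⟨(h k).1, ?_⟩⟩
  have := (h k).2
  rwa [Metric.thickening_singleton, frontier_ball x (h k).1.ne',
    ← frontier_closedBall x (h k).1.ne'] at this

section Limits

variable {E F : Type*} [NormedAddCommGroup E] [NormedSpace ℝ E] [FiniteDimensional ℝ E]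
  [MeasurableSpace E] [BorelSpace E] [MetricSpace F] [MeasurableSpace F] [BorelSpace F]
  [SecondCountableTopology F] {μ : ℕ → Measure E} [∀ n, IsProbabilityMeasure (μ n)]
  {μ₀ : Measure E} [IsProbabilityMeasure μ₀] {κ : ℕ → Kernel E F} [∀ n, IsMarkovKernel (κ n)]
  {κ₀ : Kernel E F} [IsMarkovKernel κ₀] {A : Set E}

/-- Along suitable radii `r k → 0`, the averages of the limit kernel over the balls of radius
`r k` around `x` approximate `∫ u d(κ n x)` for large `n`. The radii do not depend on `u`; balls
around points of the support have positive mass, so that the averages carry information. -/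
theorem exists_seq_average_approx
    (hQ : Tendsto (fun n => jointLaw (μ n) (κ n)) atTop (𝓝 (jointLaw μ₀ κ₀)))
    (hAs : A ⊆ μ₀.support) {x : E} (hx : x ∈ A) :
    ∃ r : ℕ → ℝ, Tendsto r atTop (𝓝[>] 0) ∧ ∀ u : F →ᵇ ℂ,
      AsymptoticallyEquicontinuousOn (fun n x => ∫ z, u z ∂(κ n x)) A → ∀ ε : ℝ, 0 < ε →
      ∀ᶠ k in atTop, ∀ᶠ n in atTop, ‖(∫ z, u z ∂(κ n x)) -
        ⨍ x' in Metric.closedBall x (r k), ∫ z, u z ∂(κ₀ x') ∂μ₀‖ ≤ ε := by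
  have : ProperSpace E := FiniteDimensional.proper_real E
  obtain ⟨r, hr, h⟩ := exists_seq_closedBall_frontier_null μ₀ x
  refine ⟨r, tendsto_nhdsWithin_iff.2 ⟨hr, Eventually.of_forall fun k => (h k).1⟩,
    fun u hu ε hε => ?_⟩
  obtain ⟨δ, hδ, N, hN⟩ := hu (ε / 2) (half_pos hε) x hx
  filter_upwards [hr.eventually_le_const hδ] with k hk
  have hB₀ := ((Measure.mem_support_iff_forall x).1 (hAs hx) _
    (Metric.closedBall_mem_nhds x (h k).1)).ne'
  have := eventually_norm_sub_setAverage_le hQ u (half_pos hε) (h k).2 hB₀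
    fun x' hx' n hn => hN x' (hx'.trans hk) n hn
  simpa [mul_div_cancel₀] using this

/-- At every point of `A`, the integrals of an asymptotically equicontinuous test function
converge. The limit need not be the integral with respect to `κ₀ x`, a kernel which is only
determined up to null sets. -/
theorem exists_tendsto_integral_kernel
    (hQ : Tendsto (fun n => jointLaw (μ n) (κ n)) atTop (𝓝 (jointLaw μ₀ κ₀)))
    (hAs : A ⊆ μ₀.support) {x : E} (hx : x ∈ A) {u : F →ᵇ ℂ}
    (hu : AsymptoticallyEquicontinuousOn (fun n x => ∫ z, u z ∂(κ n x)) A) :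
    ∃ c, Tendsto (fun n => ∫ z, u z ∂(κ n x)) atTop (𝓝 c) := by
  obtain ⟨r, -, h⟩ := exists_seq_average_approx hQ hAs hx
  refine cauchySeq_tendsto_of_complete (Metric.cauchySeq_iff'.2 fun ε hε => ?_)
  obtain ⟨k, hk⟩ := (h u hu (ε / 3) (by positivity)).exists
  obtain ⟨N, hN⟩ := eventually_atTop.1 hk
  refine ⟨N, fun n hn => ?_⟩
  have h1 := hN n hn
  have h2 := hN N le_rfl
  rw [← dist_eq_norm] at h1 h2
  linarith [dist_triangle_right (∫ z, u z ∂(κ n x)) (∫ z, u z ∂(κ N x))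
    (⨍ x' in Metric.closedBall x (r k), ∫ z, u z ∂(κ₀ x') ∂μ₀)]

/-- At almost every point, the limit of the integrals is the integral with respect to the limit
kernel, simultaneously for the possibly uncountably many test functions `u`. -/
theorem ae_tendsto_integral_kernel
    (hQ : Tendsto (fun n => jointLaw (μ n) (κ n)) atTop (𝓝 (jointLaw μ₀ κ₀)))
    (hAs : A ⊆ μ₀.support) (hA : ∀ᵐ x ∂μ₀, x ∈ A) :
    ∀ᵐ x ∂μ₀, ∀ u : F →ᵇ ℂ,
      AsymptoticallyEquicontinuousOn (fun n x => ∫ z, u z ∂(κ n x)) A →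
      Tendsto (fun n => ∫ z, u z ∂(κ n x)) atTop (𝓝 (∫ z, u z ∂(κ₀ x))) := by
  have : ProperSpace E := FiniteDimensional.proper_real E
  filter_upwards [hA, ae_tendsto_average_kernel μ₀ κ₀] with x hx hav u hu
  obtain ⟨r, hr, h⟩ := exists_seq_average_approx hQ hAs hx
  refine Metric.tendsto_nhds.2 fun ε hε => ?_
  obtain ⟨k, hk, hk'⟩ := ((h u hu (ε / 2) (half_pos hε)).and
    (Metric.tendsto_nhds.1 ((hav u).comp hr) (ε / 2) (half_pos hε))).exists
  filter_upwards [hk] with n hn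
  rw [← dist_eq_norm] at hn
  exact (dist_triangle _ _ _).trans_lt (by simpa using add_lt_add_of_le_of_lt hn hk')

theorem ae_tendsto_kernelAt
    (hQ : Tendsto (fun n => jointLaw (μ n) (κ n)) atTop (𝓝 (jointLaw μ₀ κ₀)))
    (hAs : A ⊆ μ₀.support) (hA : ∀ᵐ x ∂μ₀, x ∈ A) {U : Set (F →ᵇ ℂ)}
    (hU : IsConvergenceDetermining U)
    (hUA : ∀ u ∈ U, AsymptoticallyEquicontinuousOn (fun n x => ∫ z, u z ∂(κ n x)) A) :
    ∀ᵐ x ∂μ₀, Tendsto (fun q : ℕ × E => kernelAt (κ q.1) q.2) (atTop ×ˢ 𝓝 x)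
      (𝓝 (kernelAt κ₀ x)) := by
  filter_upwards [hA, ae_tendsto_integral_kernel hQ hAs hA] with x hx h
  exact tendsto_kernelAt_of_isConvergenceDetermining hU hUA hx fun u hu => h u (hUA u hu)

theorem exists_tendsto_kernelAt_of_isStronglyConvergenceDetermining
    (hQ : Tendsto (fun n => jointLaw (μ n) (κ n)) atTop (𝓝 (jointLaw μ₀ κ₀)))
    (hAs : A ⊆ μ₀.support) {U : Set (F →ᵇ ℂ)} (hU : IsConvergenceDetermining U)
    (hU' : IsStronglyConvergenceDetermining U)
    (hUA : ∀ u ∈ U, AsymptoticallyEquicontinuousOn (fun n x => ∫ z, u z ∂(κ n x)) A)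
    {x : E} (hx : x ∈ A) :
    ∃ ν, Tendsto (fun q : ℕ × E => kernelAt (κ q.1) q.2) (atTop ×ˢ 𝓝 x) (𝓝 ν) := by
  obtain ⟨ν, hν⟩ := hU' (fun n => kernelAt (κ n) x) fun u hu =>
    exists_tendsto_integral_kernel hQ hAs hx (hUA u hu)
  exact ⟨ν, tendsto_kernelAt_of_isConvergenceDetermining hU hUA hx fun u _ =>
    (ProbabilityMeasure.tendsto_iff_forall_integral_rclike_tendsto ℂ).1 hν u⟩

/-- If the limit kernel is locally tight on `A`, the kernels converge at every point `x` of `A`.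
Almost everywhere convergence provides points `y k → x` with `κ n (y k) → κ₀ (y k)`; by Prokhorov's
theorem the measures `κ₀ (y k)` have a weak limit point, and asymptotic equicontinuity at `x`
identifies it as the limit of `κ n x`. -/
theorem exists_tendsto_kernelAt_of_isTightMeasureSet
    (hQ : Tendsto (fun n => jointLaw (μ n) (κ n)) atTop (𝓝 (jointLaw μ₀ κ₀)))
    (hAs : A ⊆ μ₀.support) (hA : ∀ᵐ x ∂μ₀, x ∈ A) {U : Set (F →ᵇ ℂ)}
    (hU : IsConvergenceDetermining U)
    (hUA : ∀ u ∈ U, AsymptoticallyEquicontinuousOn (fun n x => ∫ z, u z ∂(κ n x)) A)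
    (ht : ∀ K : Set E, IsCompact K → K ⊆ A → IsTightMeasureSet ((fun x => κ₀ x) '' K))
    {x : E} (hx : x ∈ A) :
    ∃ ν, Tendsto (fun q : ℕ × E => kernelAt (κ q.1) q.2) (atTop ×ˢ 𝓝 x) (𝓝 ν) := by
  have hG := hA.and (ae_tendsto_integral_kernel hQ hAs hA)
  -- `x` lies in the support, so every ball around it contains points of the full-measure set
  have hex : ∀ k : ℕ, ∃ y, dist y x < 1 / ((k : ℝ) + 1) ∧ y ∈ A ∧ ∀ u ∈ U,
      Tendsto (fun n => ∫ z, u z ∂(κ n y)) atTop (𝓝 (∫ z, u z ∂(κ₀ y))) := by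
    intro k
    have hpos := (Measure.mem_support_iff_forall x).1 (hAs hx) _
      (Metric.ball_mem_nhds x (Nat.one_div_pos_of_nat (n := k) (α := ℝ)))
    obtain ⟨y, hy, hy'⟩ :=
      ((frequently_ae_mem_iff.2 hpos.ne').and_eventually hG).exists
    exact ⟨y, hy, hy'.1, fun u hu => hy'.2 u (hUA u hu)⟩
  choose y hyx hyA hy using hex
  have hyx' : Tendsto y atTop (𝓝 x) := tendsto_iff_dist_tendsto_zero.2
    (squeeze_zero (fun _ => dist_nonneg) (fun k => (hyx k).le)
      tendsto_one_div_add_atTop_nhds_zero_nat)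
  have htight := ht _ hyx'.isCompact_insert_range
    (Set.insert_subset hx (Set.range_subset_iff.2 hyA))
  have hcomp : IsCompact (closure (Set.range fun k => kernelAt κ₀ (y k))) := by
    refine isCompact_closure_of_isTightMeasureSet (htight.subset ?_)
    rintro _ ⟨_, ⟨k, rfl⟩, rfl⟩
    exact ⟨y k, Set.mem_insert_of_mem _ ⟨k, rfl⟩, rfl⟩
  obtain ⟨ν, -, φ, hφ, hν⟩ := hcomp.tendsto_subseq fun k => subset_closure ⟨k, rfl⟩
  refine ⟨ν, tendsto_kernelAt_of_isConvergenceDetermining hU hUA hx fun u hu => ?_⟩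
  have hνu := (ProbabilityMeasure.tendsto_iff_forall_integral_rclike_tendsto ℂ).1 hν u
  refine Metric.tendsto_nhds.2 fun ε hε => ?_
  have hε3 : 0 < ε / 3 := by positivity
  obtain ⟨δ, hδ, N, hN⟩ := hUA u hu (ε / 3) hε3 x hx
  obtain ⟨k, hk, hk'⟩ := (((hyx'.comp hφ.tendsto_atTop).eventually
    (Metric.closedBall_mem_nhds x hδ)).and (Metric.tendsto_nhds.1 hνu _ hε3)).exists
  filter_upwards [eventually_gt_atTop N, Metric.tendsto_nhds.1 (hy (φ k) u hu) _ hε3] with n hn hn'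
  have h1 := hN (y (φ k)) hk n hn
  rw [← dist_eq_norm, dist_comm] at h1
  change dist (∫ z, u z ∂(κ₀ (y (φ k)))) _ < _ at hk'
  linarith [dist_triangle4 (∫ z, u z ∂(κ n x)) (∫ z, u z ∂(κ n (y (φ k))))
    (∫ z, u z ∂(κ₀ (y (φ k)))) (∫ z, u z ∂(ν : Measure F))]

end Limits

/-- Weak convergence of the marginals and almost everywhere continuous convergence of the kernels
imply weak convergence of the joint laws. -/
theorem tendsto_jointLaw_of_tendsto_kernelAt {E F : Type*} [MetricSpace E] [MeasurableSpace E]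
    [BorelSpace E] [SecondCountableTopology E] [MetricSpace F] [MeasurableSpace F] [BorelSpace F]
    [SecondCountableTopology F] {μ : ℕ → Measure E} [∀ n, IsProbabilityMeasure (μ n)]
    {μ₀ : Measure E} [IsProbabilityMeasure μ₀] {κ : ℕ → Kernel E F} [∀ n, IsMarkovKernel (κ n)]
    {κ₀ : Kernel E F} [IsMarkovKernel κ₀]
    (hμ : Tendsto (β := ProbabilityMeasure E) (fun n => ⟨μ n, inferInstance⟩) atTop
      (𝓝 ⟨μ₀, inferInstance⟩))
    (h : ∀ᵐ x ∂μ₀, Tendsto (fun q : ℕ × E => kernelAt (κ q.1) q.2) (atTop ×ˢ 𝓝 x)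
      (𝓝 (kernelAt κ₀ x))) :
    Tendsto (fun n => jointLaw (μ n) (κ n)) atTop (𝓝 (jointLaw μ₀ κ₀)) := by
  refine ProbabilityMeasure.tendsto_iff_forall_integral_tendsto.2 fun G => ?_
  have hint : ∀ (m : Measure E) [IsProbabilityMeasure m] (k : Kernel E F) [IsMarkovKernel k],
      ∫ p, G p ∂(m ⊗ₘ k) = ∫ x, ∫ z, G (x, z) ∂(k x) ∂m := fun m _ k _ =>
    Measure.integral_compProd (G.integrable _)
  have hmeas : ∀ (k : Kernel E F) [IsMarkovKernel k],
      Measurable fun x => ∫ z, G (x, z) ∂(k x) := fun k _ =>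
    (G.continuous.stronglyMeasurable.integral_kernel_prod_right' (κ := k)).measurable
  have hbdd : ∀ (k : Kernel E F) [IsMarkovKernel k] (x : E), ‖∫ z, G (x, z) ∂(k x)‖ ≤ ‖G‖ :=
    fun k _ x => by
      simpa using norm_integral_le_of_norm_le_const (μ := k x)
        (ae_of_all _ fun z => G.norm_coe_le_norm (x, z))
  have := tendsto_integral_of_continuousConvergence hμ (fun n => hmeas (κ n)) (hmeas κ₀)
    (fun n => hbdd (κ n)) (hbdd κ₀) ?_
  · simpa only [ProbabilityMeasure.coe_mk, hint] using this
  filter_upwards [h] with x hx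
  have hd : Tendsto (fun q : ℕ × E => diracProba q.2) (atTop ×ˢ 𝓝 x) (𝓝 (diracProba x)) :=
    (continuous_diracProba.tendsto x).comp tendsto_snd
  have hp := (ProbabilityMeasure.continuous_prod.tendsto _).comp (hd.prodMk_nhds hx)
  have := ProbabilityMeasure.tendsto_iff_forall_integral_tendsto.1 hp G
  have hdir : ∀ (k : Kernel E F) [IsMarkovKernel k] (x : E),
      ∫ p, G p ∂(((diracProba x).prod (kernelAt k x) : ProbabilityMeasure (E × F)) :
        Measure (E × F)) = ∫ z, G (x, z) ∂(k x) := by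
    intro k _ x
    rw [ProbabilityMeasure.toMeasure_prod]
    change ∫ p, G p ∂((Measure.dirac x).prod (k x)) = _
    rw [integral_prod _ (G.integrable _), integral_dirac]
  simpa only [Function.comp_def, hdir] using this

/-! ### Conditionally independent copies -/

theorem hasCondDistrib_condDistrib {Ω E : Type*} [MeasurableSpace Ω] [MeasurableSpace E]
    {P : Measure Ω} [IsFiniteMeasure P] {X : Ω → E} {Y : Ω → ℝ} (hX : Measurable X)
    (hY : Measurable Y) : HasCondDistrib Y X (condDistrib Y X P) P :=
  ⟨by fun_prop, (compProd_map_condDistrib hY.aemeasurable).symm⟩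

theorem IsCondIndepCopy.measureReal_preimage_inter {Ω E : Type*} [MeasurableSpace Ω]
    [MeasurableSpace E] {P : Measure Ω} [IsProbabilityMeasure P] {X : Ω → E} {Y Y' : Ω → ℝ}
    (hX : Measurable X) (hY : Measurable Y) (hY' : Measurable Y')
    (h : IsCondIndepCopy P X Y Y') {s : Set E} {A B : Set ℝ} (hs : MeasurableSet s)
    (hA : MeasurableSet A) (hB : MeasurableSet B) :
    P.real (X ⁻¹' s ∩ (Y ⁻¹' A ∩ Y' ⁻¹' B)) =
      ∫ ω in X ⁻¹' s, (condDistrib Y X P (X ω)).real A * (condDistrib Y X P (X ω)).real B ∂P := by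
  have hAB : MeasurableSet (Y ⁻¹' A ∩ Y' ⁻¹' B) := (hY hA).inter (hY' hB)
  have h1 := setIntegral_condExp (μ := P) hX.comap_le
    (f := (Y ⁻¹' A ∩ Y' ⁻¹' B).indicator fun _ => (1 : ℝ))
    ((integrable_const _).indicator hAB) (s := X ⁻¹' s) ⟨s, hs, rfl⟩
  rw [integral_indicator_const _ hAB, smul_eq_mul, mul_one, measureReal_restrict_apply hAB,
    Set.inter_comm _ (X ⁻¹' s)] at h1
  rw [← h1]
  refine integral_congr_ae (ae_restrict_of_ae ?_)
  have h2 := ae_of_ae_map hX.aemeasurable h.condDistrib_eq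
  filter_upwards [h.condIndep A B hA hB, condDistrib_ae_eq_condExp (μ := P) hX hY hA,
    condDistrib_ae_eq_condExp (μ := P) hX hY' hB, h2] with ω e1 e2 e3 e4
  rw [e1, Pi.mul_apply, ← e2, ← e3, e4]

/-- Given `X`, the pair of `Y` and a conditionally independent copy has the conditional
distribution `x ↦ κ x ⊗ κ x`, for every version `κ` of the conditional distribution of `Y`. -/
theorem IsCondIndepCopy.hasCondDistrib_prod {Ω E : Type*} [MeasurableSpace Ω] [MeasurableSpace E]
    {P : Measure Ω} [IsProbabilityMeasure P] {X : Ω → E} {Y Y' : Ω → ℝ}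
    (h : IsCondIndepCopy P X Y Y') (hX : Measurable X)
    (hY : Measurable Y) (hY' : Measurable Y') {κ : Kernel E ℝ} [IsMarkovKernel κ]
    (hκ : HasCondDistrib Y X κ P) :
    HasCondDistrib (fun ω => (Y ω, Y' ω)) X (κ ×ₖ κ) P where
  aemeasurable := by fun_prop
  map_eq := by
    have : IsProbabilityMeasure (P.map X) := Measure.isProbabilityMeasure_map hX.aemeasurable
    have hae : ∀ᵐ ω ∂P, condDistrib Y X P (X ω) = κ (X ω) := ae_of_ae_map hX.aemeasurable
      (condDistrib_ae_eq_of_measure_eq_compProd X hY.aemeasurable hκ.map_eq)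
    have : IsProbabilityMeasure (P.map fun ω => (X ω, Y ω, Y' ω)) :=
      Measure.isProbabilityMeasure_map (by fun_prop)
    refine Measure.ext_prod₃ fun {s A B} hs hA hB => ?_
    rw [← measureReal_eq_measureReal_iff, map_measureReal_apply (by fun_prop)
      (hs.prod (hA.prod hB))]
    have e : (fun ω => (X ω, Y ω, Y' ω)) ⁻¹' (s ×ˢ A ×ˢ B) =
        X ⁻¹' s ∩ (Y ⁻¹' A ∩ Y' ⁻¹' B) := rfl
    have hmeas : Measurable fun x => κ x A * κ x B :=
      (κ.measurable_coe hA).mul (κ.measurable_coe hB)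
    rw [e, h.measureReal_preimage_inter hX hY hY' hs hA hB, Measure.real,
      Measure.compProd_apply_prod hs (hA.prod hB)]
    simp only [Kernel.prod_apply, Measure.prod_prod]
    rw [setLIntegral_map hs hmeas hX, ← integral_toReal (f := fun ω => κ (X ω) A * κ (X ω) B)
      (hmeas.comp hX).aemeasurable
      (ae_of_all _ fun _ => ENNReal.mul_lt_top (measure_lt_top _ _) (measure_lt_top _ _))]
    refine integral_congr_ae (ae_restrict_of_ae ?_)
    filter_upwards [hae] with ω hω
    simp [hω, Measure.real]

theorem tendstoInDistribution_prodMk_iff {E F : Type*} [MeasurableSpace E] [TopologicalSpace E]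
    [MeasurableSpace F] [TopologicalSpace F] [OpensMeasurableSpace (E × F)]
    {Ω₀ : Type*} [MeasurableSpace Ω₀] {P : Measure Ω₀} [IsProbabilityMeasure P]
    {Ω : ℕ → Type*} [∀ n, MeasurableSpace (Ω n)] {Pn : ∀ n, Measure (Ω n)}
    [∀ n, IsProbabilityMeasure (Pn n)] {X : Ω₀ → E} {Z : Ω₀ → F} {Xn : ∀ n, Ω n → E}
    {Zn : ∀ n, Ω n → F} [IsProbabilityMeasure (P.map X)]
    [∀ n, IsProbabilityMeasure ((Pn n).map (Xn n))] {κ : ℕ → Kernel E F}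
    [∀ n, IsMarkovKernel (κ n)] {κ₀ : Kernel E F} [IsMarkovKernel κ₀]
    (hκ : ∀ n, HasCondDistrib (Zn n) (Xn n) (κ n) (Pn n)) (hκ₀ : HasCondDistrib Z X κ₀ P) :
    TendstoInDistribution (fun n ω => (Xn n ω, Zn n ω)) atTop (fun ω => (X ω, Z ω)) Pn P ↔
      Tendsto (fun n => jointLaw ((Pn n).map (Xn n)) (κ n)) atTop
        (𝓝 (jointLaw (P.map X) κ₀)) := by
  have e₀ : ∀ h, (⟨P.map fun ω => (X ω, Z ω), h⟩ : ProbabilityMeasure (E × F)) =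
      jointLaw (P.map X) κ₀ := fun h => Subtype.ext hκ₀.map_eq
  have e : ∀ n h, (⟨(Pn n).map fun ω => (Xn n ω, Zn n ω), h⟩ : ProbabilityMeasure (E × F)) =
      jointLaw ((Pn n).map (Xn n)) (κ n) := fun n h => Subtype.ext (hκ n).map_eq
  refine ⟨fun h => ?_, fun h => ⟨fun n => (hκ n).aemeasurable, hκ₀.aemeasurable, ?_⟩⟩
  · simpa only [e₀, e] using h.tendsto
  · simpa only [e₀, e] using h

theorem isTightMeasureSet_image_kernel_prod {E F : Type*} [MeasurableSpace E] [TopologicalSpace F]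
    [MeasurableSpace F] {κ : Kernel E F} [IsMarkovKernel κ] {K : Set E}
    (h : IsTightMeasureSet ((fun x => κ x) '' K)) :
    IsTightMeasureSet ((fun x => (κ ×ₖ κ) x) '' K) := by
  refine IsTightMeasureSet.prodMk ?_ ?_ <;>
  · rw [Set.image_image]
    simpa [Kernel.prod_apply] using h

/-- Continuous weak convergence of the conditional distributions on `A`, with whatever limits,
makes the conditional expectations of every bounded continuous function asymptotically
equicontinuous on `A`. -/
theorem condExpAsymptoticallyEquicontinuousOn_of_exists_tendsto {E F : Type*} [PseudoMetricSpace E]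
    [MeasurableSpace E] [TopologicalSpace F] [MeasurableSpace F] [OpensMeasurableSpace F]
    {Ω : ℕ → Type*} [∀ n, MeasurableSpace (Ω n)] {Pn : ∀ n, Measure (Ω n)} {Xn : ∀ n, Ω n → E}
    {A : Set E} {Zn : ∀ n, Ω n → F} {κ : ℕ → Kernel E F} [hM : ∀ n, IsMarkovKernel (κ n)]
    (hκ : ∀ n, HasCondDistrib (Zn n) (Xn n) (κ n) (Pn n))
    (h : ∀ x ∈ A, ∃ ν, Tendsto (fun q : ℕ × E => kernelAt (κ q.1) q.2) (atTop ×ˢ 𝓝 x) (𝓝 ν))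
    (U : Set (F →ᵇ ℂ)) : CondExpAsymptoticallyEquicontinuousOn Pn Xn Zn U A :=
  ⟨κ, hM, hκ, fun u _ => asymptoticallyEquicontinuousOn_of_tendsto fun x hx =>
    let ⟨_, hν⟩ := h x hx
    ⟨_, tendsto_integral_of_tendsto_kernelAt hν u⟩⟩

/-! ### From single variables to pairs and back -/

section Equivalence

variable {E : Type*} [NormedAddCommGroup E] [NormedSpace ℝ E] [FiniteDimensional ℝ E]
  [MeasurableSpace E] [BorelSpace E]
  {Ω₀ : Type*} [MeasurableSpace Ω₀] {P : Measure Ω₀} [IsProbabilityMeasure P]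
  {Ω : ℕ → Type*} [∀ n, MeasurableSpace (Ω n)] {Pn : ∀ n, Measure (Ω n)}
  [∀ n, IsProbabilityMeasure (Pn n)] {X : Ω₀ → E} {Y Y' : Ω₀ → ℝ}
  {Xn : ∀ n, Ω n → E} {Yn Yn' : ∀ n, Ω n → ℝ} {A : Set E}

/-- Convergence of the triples. At almost every point the kernels `κ n` converge continuously, so
their products with themselves do, and these are the conditional distributions of the pairs. -/
theorem tendstoInDistribution_condIndepCopy (hX : Measurable X) (hY : Measurable Y)
    (hY' : Measurable Y') (hXn : ∀ n, Measurable (Xn n)) (hYn : ∀ n, Measurable (Yn n))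
    (hYn' : ∀ n, Measurable (Yn' n)) (hcopy : IsCondIndepCopy P X Y Y')
    (hcopyn : ∀ n, IsCondIndepCopy (Pn n) (Xn n) (Yn n) (Yn' n))
    (hAs : A ⊆ (P.map X).support) (hA : ∀ᵐ x ∂(P.map X), x ∈ A) {U : Set (ℝ →ᵇ ℂ)}
    (hU : IsConvergenceDetermining U)
    (h : TendstoInDistribution (fun n ω => (Xn n ω, Yn n ω)) atTop (fun ω => (X ω, Y ω)) Pn P)
    (hc : CondExpAsymptoticallyEquicontinuousOn Pn Xn Yn U A) :
    TendstoInDistribution (fun n ω => (Xn n ω, Yn n ω, Yn' n ω)) atTop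
      (fun ω => (X ω, Y ω, Y' ω)) Pn P := by
  have : ProperSpace E := FiniteDimensional.proper_real E
  obtain ⟨κ, hκM, hκ, hUA⟩ := hc
  have hμ₀ : IsProbabilityMeasure (P.map X) := Measure.isProbabilityMeasure_map hX.aemeasurable
  have hμ : ∀ n, IsProbabilityMeasure ((Pn n).map (Xn n)) := fun n =>
    Measure.isProbabilityMeasure_map (hXn n).aemeasurable
  have hκ₀ := hasCondDistrib_condDistrib (P := P) hX hY
  have hlim := ae_tendsto_kernelAt ((tendstoInDistribution_prodMk_iff hκ hκ₀).1 h) hAs hA hU hUA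
  refine (tendstoInDistribution_prodMk_iff
    (fun n => (hcopyn n).hasCondDistrib_prod (hXn n) (hYn n) (hYn' n) (hκ n))
    (hcopy.hasCondDistrib_prod hX hY hY' hκ₀)).2 (tendsto_jointLaw_of_tendsto_kernelAt ?_ ?_)
  · exact (h.continuous_comp continuous_fst).tendsto
  · filter_upwards [hlim] with x hx
    have := (ProbabilityMeasure.continuous_prod.tendsto _).comp (hx.prodMk_nhds hx)
    simpa only [kernelAt_prod_self, Function.comp_def] using this

theorem exists_tendsto_kernelAt_of_tendstoInDistribution {F : Type*} [MetricSpace F]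
    [MeasurableSpace F] [BorelSpace F] [SecondCountableTopology F] {Z : Ω₀ → F}
    {Zn : ∀ n, Ω n → F} (hX : Measurable X) (hXn : ∀ n, Measurable (Xn n))
    (hAs : A ⊆ (P.map X).support) (hA : ∀ᵐ x ∂(P.map X), x ∈ A) {U : Set (F →ᵇ ℂ)}
    (hU : IsConvergenceDetermining U) {κ : ℕ → Kernel E F} [∀ n, IsMarkovKernel (κ n)]
    {κ₀ : Kernel E F} [IsMarkovKernel κ₀]
    (hκ : ∀ n, HasCondDistrib (Zn n) (Xn n) (κ n) (Pn n)) (hκ₀ : HasCondDistrib Z X κ₀ P)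
    (h : TendstoInDistribution (fun n ω => (Xn n ω, Zn n ω)) atTop (fun ω => (X ω, Z ω)) Pn P)
    (hUA : ∀ u ∈ U, AsymptoticallyEquicontinuousOn (fun n x => ∫ z, u z ∂(κ n x)) A)
    (hst : (∀ K : Set E, IsCompact K → K ⊆ A → IsTightMeasureSet ((fun x => κ₀ x) '' K)) ∨
      IsStronglyConvergenceDetermining U) {x : E} (hx : x ∈ A) :
    ∃ ν, Tendsto (fun q : ℕ × E => kernelAt (κ q.1) q.2) (atTop ×ˢ 𝓝 x) (𝓝 ν) := by
  have : ProperSpace E := FiniteDimensional.proper_real E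
  have hμ₀ : IsProbabilityMeasure (P.map X) := Measure.isProbabilityMeasure_map hX.aemeasurable
  have hμ : ∀ n, IsProbabilityMeasure ((Pn n).map (Xn n)) := fun n =>
    Measure.isProbabilityMeasure_map (hXn n).aemeasurable
  have hQ := (tendstoInDistribution_prodMk_iff hκ hκ₀).1 h
  rcases hst with ht | hs
  · exact exists_tendsto_kernelAt_of_isTightMeasureSet hQ hAs hA hU hUA ht hx
  · exact exists_tendsto_kernelAt_of_isStronglyConvergenceDetermining hQ hAs hU hs hUA hx

/-- Passage from the single variables to the pairs: the products `κ n ×ₖ κ n` converge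
continuously at every point of `A` because the kernels `κ n` do. -/
theorem condExpAsymptoticallyEquicontinuousOn_prod (hX : Measurable X)
    (hXn : ∀ n, Measurable (Xn n)) (hYn : ∀ n, Measurable (Yn n))
    (hYn' : ∀ n, Measurable (Yn' n))
    (hcopyn : ∀ n, IsCondIndepCopy (Pn n) (Xn n) (Yn n) (Yn' n))
    (hAs : A ⊆ (P.map X).support) (hA : ∀ᵐ x ∂(P.map X), x ∈ A) {U : Set (ℝ →ᵇ ℂ)}
    (hU : IsConvergenceDetermining U) {κ₀ : Kernel E ℝ} [IsMarkovKernel κ₀]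
    (hκ₀ : HasCondDistrib Y X κ₀ P)
    (hst : (∀ K : Set E, IsCompact K → K ⊆ A → IsTightMeasureSet ((fun x => κ₀ x) '' K)) ∨
      IsStronglyConvergenceDetermining U)
    (h : TendstoInDistribution (fun n ω => (Xn n ω, Yn n ω)) atTop (fun ω => (X ω, Y ω)) Pn P)
    (hc : CondExpAsymptoticallyEquicontinuousOn Pn Xn Yn U A) (U' : Set (ℝ × ℝ →ᵇ ℂ)) :
    CondExpAsymptoticallyEquicontinuousOn Pn Xn (fun n ω => (Yn n ω, Yn' n ω)) U' A := by
  obtain ⟨κ, hκM, hκ, hUA⟩ := hc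
  refine condExpAsymptoticallyEquicontinuousOn_of_exists_tendsto
    (fun n => (hcopyn n).hasCondDistrib_prod (hXn n) (hYn n) (hYn' n) (hκ n)) (fun x hx => ?_) U'
  obtain ⟨ν, hν⟩ := exists_tendsto_kernelAt_of_tendstoInDistribution hX hXn hAs hA hU hκ hκ₀ h
    hUA hst hx
  have := (ProbabilityMeasure.continuous_prod.tendsto _).comp (hν.prodMk_nhds hν)
  exact ⟨ν.prod ν, by simpa only [kernelAt_prod_self, Function.comp_def] using this⟩

/-- Passage from the pairs to the single variables: the first marginals of the conditional
distributions of the pairs converge continuously at every point of `A`. Local tightness of `κ₀`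
passes to `κ₀ ×ₖ κ₀`, which is the conditional distribution of the limit pair. -/
theorem condExpAsymptoticallyEquicontinuousOn_fst (hX : Measurable X) (hY : Measurable Y)
    (hY' : Measurable Y') (hXn : ∀ n, Measurable (Xn n)) (hcopy : IsCondIndepCopy P X Y Y')
    (hAs : A ⊆ (P.map X).support) (hA : ∀ᵐ x ∂(P.map X), x ∈ A) {U : Set (ℝ × ℝ →ᵇ ℂ)}
    (hU : IsConvergenceDetermining U) {κ₀ : Kernel E ℝ} [IsMarkovKernel κ₀]
    (hκ₀ : HasCondDistrib Y X κ₀ P)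
    (hst : (∀ K : Set E, IsCompact K → K ⊆ A → IsTightMeasureSet ((fun x => κ₀ x) '' K)) ∨
      IsStronglyConvergenceDetermining U)
    (h : TendstoInDistribution (fun n ω => (Xn n ω, Yn n ω, Yn' n ω)) atTop
      (fun ω => (X ω, Y ω, Y' ω)) Pn P)
    (hc : CondExpAsymptoticallyEquicontinuousOn Pn Xn (fun n ω => (Yn n ω, Yn' n ω)) U A)
    (U' : Set (ℝ →ᵇ ℂ)) : CondExpAsymptoticallyEquicontinuousOn Pn Xn Yn U' A := by
  obtain ⟨κ, hκM, hκ, hUA⟩ := hc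
  refine condExpAsymptoticallyEquicontinuousOn_of_exists_tendsto (fun n => (hκ n).fst)
    (fun x hx => ?_) U'
  obtain ⟨ν, hν⟩ := exists_tendsto_kernelAt_of_tendstoInDistribution hX hXn hAs hA hU hκ
    (hcopy.hasCondDistrib_prod hX hY hY' hκ₀) h hUA
    (hst.imp_left fun ht K hK hKA => isTightMeasureSet_image_kernel_prod (ht K hK hKA)) hx
  have := ((ProbabilityMeasure.continuous_map continuous_fst).tendsto _).comp hν
  have e : ∀ (k : Kernel E (ℝ × ℝ)) [IsMarkovKernel k] (y : E),
      kernelAt k.fst y = (kernelAt k y).map continuous_fst.measurable.aemeasurable := fun k _ y =>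
    Subtype.ext (Kernel.fst_apply k y)
  exact ⟨_, by simpa only [e, Function.comp_def] using this⟩

end Equivalence

theorem mainTheorem1 {p : ℕ}
    {Ω₀ : Type*} [MeasurableSpace Ω₀] (P : Measure Ω₀) [IsProbabilityMeasure P]
    {Ω : ℕ → Type*} [∀ n, MeasurableSpace (Ω n)] (Pn : ∀ n, Measure (Ω n))
    [∀ n, IsProbabilityMeasure (Pn n)]
    (X : Ω₀ → EuclideanSpace ℝ (Fin p)) (Y Y' : Ω₀ → ℝ)
    (Xn : ∀ n, Ω n → EuclideanSpace ℝ (Fin p)) (Yn Yn' : ∀ n, Ω n → ℝ)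
    (hX : Measurable X) (hY : Measurable Y) (hY' : Measurable Y')
    (hXn : ∀ n, Measurable (Xn n)) (hYn : ∀ n, Measurable (Yn n))
    (hYn' : ∀ n, Measurable (Yn' n))
    (hcopy : IsCondIndepCopy P X Y Y')
    (hcopyn : ∀ n, IsCondIndepCopy (Pn n) (Xn n) (Yn n) (Yn' n))
    (V : Set (EuclideanSpace ℝ (Fin p))) (hVo : IsOpen V) (hV : P (X ⁻¹' V) = 1)
    (U₁ : Set (ℝ →ᵇ ℂ)) (hU₁ : IsConvergenceDetermining U₁)
    (U₂ : Set (ℝ × ℝ →ᵇ ℂ)) (hU₂ : IsConvergenceDetermining U₂) :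
    -- (1) implies convergence of the triples and of the Markov products
    (TendstoInDistribution (fun n ω => (Xn n ω, Yn n ω)) atTop (fun ω => (X ω, Y ω)) Pn P ∧
        CondExpAsymptoticallyEquicontinuousOn Pn Xn Yn U₁ (V ∩ (P.map X).support) →
      TendstoInDistribution (fun n ω => (Xn n ω, Yn n ω, Yn' n ω)) atTop
          (fun ω => (X ω, Y ω, Y' ω)) Pn P ∧
        TendstoInDistribution (fun n ω => (Yn n ω, Yn' n ω)) atTop
          (fun ω => (Y ω, Y' ω)) Pn P) ∧
    -- equivalence of (1) and (2)
    (CondDistribLocallyTightOn P X Y (V ∩ (P.map X).support) ∨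
        (IsStronglyConvergenceDetermining U₁ ∧ IsStronglyConvergenceDetermining U₂) →
      ((TendstoInDistribution (fun n ω => (Xn n ω, Yn n ω)) atTop (fun ω => (X ω, Y ω)) Pn P ∧
          CondExpAsymptoticallyEquicontinuousOn Pn Xn Yn U₁ (V ∩ (P.map X).support)) ↔
        (TendstoInDistribution (fun n ω => (Xn n ω, Yn n ω, Yn' n ω)) atTop
            (fun ω => (X ω, Y ω, Y' ω)) Pn P ∧
          CondExpAsymptoticallyEquicontinuousOn Pn Xn
            (fun n ω => (Yn n ω, Yn' n ω)) U₂ (V ∩ (P.map X).support)))) := by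
  set A := V ∩ (P.map X).support
  have hAs : A ⊆ (P.map X).support := Set.inter_subset_right
  have hA : ∀ᵐ x ∂(P.map X), x ∈ A := by
    have hVae : ∀ᵐ x ∂(P.map X), x ∈ V := (ae_map_iff hX.aemeasurable hVo.measurableSet).2
      ((mem_ae_iff_prob_eq_one (hX hVo.measurableSet)).2 hV)
    exact hVae.and Measure.support_mem_ae
  have ha := fun h => tendstoInDistribution_condIndepCopy hX hY hY' hXn hYn hYn' hcopy hcopyn
    hAs hA hU₁ h
  refine ⟨fun h => ⟨ha h.1 h.2, (ha h.1 h.2).continuous_comp continuous_snd⟩, fun hst => ?_⟩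
  -- in the strongly determining case tightness plays no role, so that any version `κ₀` serves
  have hκ₀ : ∃ κ₀ : Kernel (EuclideanSpace ℝ (Fin p)) ℝ, IsMarkovKernel κ₀ ∧
      HasCondDistrib Y X κ₀ P ∧
      ((∀ K, IsCompact K → K ⊆ A → IsTightMeasureSet ((fun x => κ₀ x) '' K)) ∨
        (IsStronglyConvergenceDetermining U₁ ∧ IsStronglyConvergenceDetermining U₂)) := by
    rcases hst with ⟨κ₀, hM, hκ₀, ht⟩ | hs
    · exact ⟨κ₀, hM, hκ₀, Or.inl ht⟩
    · exact ⟨condDistrib Y X P, inferInstance, hasCondDistrib_condDistrib hX hY, Or.inr hs⟩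
  obtain ⟨κ₀, hM, hκ₀, hst⟩ := hκ₀
  refine ⟨fun h => ⟨ha h.1 h.2, ?_⟩, fun h => ⟨?_, ?_⟩⟩
  · exact condExpAsymptoticallyEquicontinuousOn_prod hX hXn hYn hYn' hcopyn hAs hA hU₁ hκ₀
      (hst.imp_right And.left) h.1 h.2 U₂
  · exact h.1.continuous_comp (continuous_fst.prodMk (continuous_fst.comp continuous_snd))
  · exact condExpAsymptoticallyEquicontinuousOn_fst hX hY hY' hXn hcopy hAs hA hU₂ hκ₀
      (hst.imp_right And.right) h.1 h.2 U₁
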